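/- **Setting.** Let $\lambda\ge 2$ and $k^I>r^F>r^I\ge 0$ be integers. An $[n,k,\alpha]$ vector MDS code over a finite field $\mathbb F_q$ is an $\mathbb F_q$-linear encoding of $k$ message symbols from $\mathbb F_q^\alpha$ into $n$ code symbols from $\mathbb F_q^\alpha$ such that any $k$ code symbols determine the message; $\alpha\ge 1$ is its sub-packetization. An MDS convertible code with parameters $(\lambda,k^I,r^I,r^F;\alpha)$ over $\mathbb F_q$ consists of an initial $[k^I+r^I,k^I,\alpha]$ vector MDS code, a final $[\lambda k^I+r^F,\lambda k^I,\alpha]$ vector MDS code, and a procedure that converts any $\lambda$ codewords of the initial code into the codeword of the final code that encodes the concatenated data. Each code symbol is stored on its own disk. Some of the initial disks are *unchanged*: their symbol is also a symbol of the final codeword, in a fixed position, distinct disks having distinct positions. The other initial disks are *retired*, and the final symbols not stored on unchanged disks are written on *new* disks. Each initial disk sends to a central coordinator a number of elements of $\mathbb F_q$ (fixed for that disk, possibly $0$) that are a function of its content. From all it receives, the coordinator computes and sends to each new disk a fixed number of elements of $\mathbb F_q$, from which that disk computes its symbol. The *bandwidth cost* is the total number of elements of $\mathbb F_q$ sent to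 and by the coordinator. The code is *bandwidth-optimal* if the ratio of its bandwidth cost to $\alpha$ is the smallest among all MDS convertible codes with the same $\lambda,k^I,r^I,r^F$, of any sub-packetization and over any finite field. It has *uniform download* if the coordinator downloads the same number of elements of $\mathbb F_q$ from every unchanged disk, and the entire content ($\alpha$ elements of $\mathbb F_q$ that determine the content) of every retired disk. **Theorem.** Let $\lambda\ge2$ and $k^I>r^F>r^I\ge 0$. 1. Every bandwidth-optimal MDS convertible code with parameters $(\lambda,k^I,r^I,r^F;\alpha)$ over a finite field that has uniform download satisfies $r^F\mid\alpha r^I$, and hence $\alpha\ge r^F/\gcd(r^F,r^I)$. 2. The value $\alpha=r^F/\gcd(r^F,r^I)$ is attained, so it is the minimum possible: over some finite field there is a bandwidth-optimal MDS convertible code with parameters $(\lambda,k^I,r^I,r^F;\,r^F/\gcd(r^F,r^I))$ that has uniform download. -/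

import Mathlib

/-- An `[n, k, α]` linear vector code over `F`, given by its encoder: `k` message symbols from
`F ^ α` are encoded into `n` code symbols from `F ^ α`. -/
abbrev VectorCode (F : Type*) [Field F] (n k α : ℕ) :=
  (Fin k → Fin α → F) →ₗ[F] (Fin n → Fin α → F)

/-- A vector code is MDS if any `k` of its code symbols determine the message. -/
def VectorCode.IsMDS {F : Type*} [Field F] {n k α : ℕ} (C : VectorCode F n k α) : Prop :=
  ∀ S : Finset (Fin n), S.card = k →
    ∀ m m' : Fin k → Fin α → F, (∀ i ∈ S, C m i = C m' i) → m = m'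

/-- The concatenation of `lam` messages of `k` symbols into one message of `lam * k` symbols. -/
def mergeMessages {A : Type*} {lam k : ℕ} (m : Fin lam → Fin k → A) : Fin (lam * k) → A :=
  fun j => m (finProdFinEquiv.symm j).1 (finProdFinEquiv.symm j).2

/-- A vector MDS convertible code in the merge regime, in the central-coordinator model:
`lam` codewords of an initial `[k + rI, k, α]` vector MDS code are converted into one codeword of a
final `[lam * k + rF, lam * k, α]` vector MDS code that encodes the same data.

The initial disks are the pairs `(ℓ, i)`: disk `(ℓ, i)` stores symbol `i` of initial codeword `ℓ`.
The final disks are the symbols of the final codeword. -/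
structure MDSConvertibleCode (F : Type*) [Field F] (lam k rI rF α : ℕ) where
  /-- the initial code -/
  initial : VectorCode F (k + rI) k α
  initial_mds : initial.IsMDS
  /-- the final code -/
  final : VectorCode F (lam * k + rF) (lam * k) α
  final_mds : final.IsMDS
  /-- the initial disks that are kept; all the other initial disks are retired -/
  unchanged : Finset (Fin lam × Fin (k + rI))
  /-- the position in the final codeword of each unchanged disk -/
  place : unchanged ↪ Fin (lam * k + rF)
  /-- an unchanged disk stores the same symbol before and after the conversion -/
  place_spec : ∀ (m : Fin lam → Fin k → Fin α → F) (d : unchanged),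
    final (mergeMessages m) (place d) = initial (m d.1.1) d.1.2
  /-- the number of elements of `F` sent by an initial disk to the coordinator -/
  readAmount : Fin lam × Fin (k + rI) → ℕ
  /-- what an initial disk sends to the coordinator, as a function of its content -/
  download : (d : Fin lam × Fin (k + rI)) → (Fin α → F) → (Fin (readAmount d) → F)
  /-- the number of elements of `F` sent by the coordinator to a new disk
  (without meaning for a final disk that is not new) -/
  writeAmount : Fin (lam * k + rF) → ℕ
  /-- what the coordinator sends to a new disk, as a function of everything it has received -/
  send : (e : Fin (lam * k + rF)) → ((d : Fin lam × Fin (k + rI)) → Fin (readAmount d) → F) →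
    (Fin (writeAmount e) → F)
  /-- what a new disk stores, as a function of what it has received -/
  store : (e : Fin (lam * k + rF)) → (Fin (writeAmount e) → F) → (Fin α → F)
  /-- after the conversion every new disk stores its symbol of the final codeword -/
  store_spec : ∀ (m : Fin lam → Fin k → Fin α → F) (e : Fin (lam * k + rF)),
    e ∉ Set.range place →
      store e (send e fun d => download d (initial (m d.1) d.2)) = final (mergeMessages m) e

namespace MDSConvertibleCode

variable {F : Type*} [Field F] {lam k rI rF α : ℕ}

/-- The new disks: the final disks that are not unchanged disks. -/
def newDisks (C : MDSConvertibleCode F lam k rI rF α) : Finset (Fin (lam * k + rF)) :=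
  (Finset.univ.map C.place)ᶜ

/-- Number of elements of `F` sent by the unchanged and the retired disks to the coordinator. -/
def readBandwidth (C : MDSConvertibleCode F lam k rI rF α) : ℕ :=
  ∑ d, C.readAmount d

/-- Number of elements of `F` sent by the coordinator to the new disks. -/
def writeBandwidth (C : MDSConvertibleCode F lam k rI rF α) : ℕ :=
  ∑ e ∈ C.newDisks, C.writeAmount e

/-- The bandwidth cost of the conversion. -/
def bandwidthCost (C : MDSConvertibleCode F lam k rI rF α) : ℕ :=
  C.readBandwidth + C.writeBandwidth

/-- Bandwidth-optimality: the bandwidth cost, in proportion to the size `α` of a code symbol, is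
the least possible among all MDS convertible codes with the same `lam, k, rI, rF`, of every
sub-packetization level and over every finite field:
`C.bandwidthCost / α ≤ C'.bandwidthCost / α'` (cross-multiplied). -/
def IsBandwidthOptimal (C : MDSConvertibleCode F lam k rI rF α) : Prop :=
  ∀ (F' : Type) [Field F'] [Finite F'] (α' : ℕ), 0 < α' →
    ∀ C' : MDSConvertibleCode F' lam k rI rF α',
      C.bandwidthCost * α' ≤ C'.bandwidthCost * α

/-- The coordinator downloads equal amounts from all unchanged disks, and the entire content
(`α` elements of `F`, which determine the content) of every retired disk. -/
def HasUniformDownload (C : MDSConvertibleCode F lam k rI rF α) : Prop :=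
  (∀ d ∈ C.unchanged, ∀ d' ∈ C.unchanged, C.readAmount d = C.readAmount d') ∧
  ∀ d ∉ C.unchanged, C.readAmount d = α ∧ Function.Injective (C.download d)

end MDSConvertibleCode

/-! Lower bound. Fix an initial codeword with `u` unchanged disks. Any `rF` final symbols may be
erased, so its message is determined by the downloads together with the full content of all but `w ≤
min u rF` of its unchanged disks. Disregarding the `w` least-read ones and averaging bounds the
download from below (`mul_le_mul_readIn_add`). Each new disk must receive `α` elements, so having
fewer than `k` unchanged disks per codeword is strictly wasteful (`le_readIn`). Summing gives
`le_bandwidthCost`. In case of equality `u = k`, and a uniform download `b` satisfies `rF * b = α *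
(rF - rI)`, whence the divisibility.

Construction. Take systematic codes and read all parities, but only the `β = α * (rF - rI) / rF` low
layers of the data. Low layers of the final parities follow from the data, and high layers of the
first `rI` from the initial parities. The `(rF - rI) * (α - β)` missing values per codeword are
piggybacked onto its `rI * β` low-layer parity entries; these numbers agree, and the known low-layer
data can be subtracted. The MDS property comes from a Vandermonde matrix at powers of 2,
superregular over the integers by Descartes' rule of signs and hence modulo a large prime. -/

/-! ### Counting and averaging -/

/-- Distinguishing all messages of `k` symbols from `F ^ α` takes at least `k * α` elements
of `F`. -/
theorem mul_le_card_of_injective {F J : Type*} [Field F] [Finite F] [Fintype J] {k α : ℕ}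
    {f : (Fin k → Fin α → F) → J → F} (hf : Function.Injective f) : k * α ≤ Fintype.card J := by
  classical
  have := Fintype.ofFinite F
  have h := Fintype.card_le_of_injective f hf
  simp only [Fintype.card_fun, Fintype.card_fin, ← pow_mul] at h
  rw [mul_comm]
  exact (Nat.pow_le_pow_iff_right Fintype.one_lt_card).1 h

/-- An average-type inequality: some `w`-subset carries at most its share of the total weight. -/
theorem Finset.exists_subset_card_mul_sum_le {ι : Type*} (U : Finset ι) (β : ι → ℕ)
    {w : ℕ} (hw : w ≤ U.card) :
    ∃ W ⊆ U, W.card = w ∧ U.card * ∑ i ∈ W, β i ≤ w * ∑ i ∈ U, β i := by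
  classical
  induction hn : U.card - w generalizing U with
  | zero => exact ⟨U, Subset.rfl, by omega, by rw [show U.card = w by omega]⟩
  | succ n ih =>
    -- Discarding a heaviest element does not raise the average.
    obtain ⟨x, hx, hmax⟩ := U.exists_max_image β (Finset.card_pos.1 (by omega))
    have hc := Finset.card_erase_of_mem hx
    obtain ⟨W, hWU, hWc, hW⟩ := ih (U.erase x) (by omega) (by omega)
    refine ⟨W, hWU.trans (U.erase_subset x), hWc, ?_⟩
    have hsum := Finset.add_sum_erase U β hx
    have hle : ∑ i ∈ U, β i ≤ U.card * β x := by
      simpa using Finset.sum_le_card_nsmul U β (β x) hmax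
    obtain ⟨v, hv⟩ : ∃ v, U.card = v + 1 := ⟨U.card - 1, by omega⟩
    rw [hc] at hW
    rw [hv] at hle hW ⊢
    simp only [Nat.add_sub_cancel] at hW
    rcases Nat.eq_zero_or_pos v with rfl | hvpos
    · have : w = 0 := by omega
      subst this
      simp [Finset.card_eq_zero.1 hWc]
    · refine Nat.le_of_mul_le_mul_left ?_ hvpos
      have h : (v + 1) * ∑ i ∈ U.erase x, β i ≤ v * ∑ i ∈ U, β i := by
        rw [← hsum] at hle ⊢
        linarith
      calc v * ((v + 1) * ∑ i ∈ W, β i) = (v + 1) * (v * ∑ i ∈ W, β i) := by ring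
        _ ≤ (v + 1) * (w * ∑ i ∈ U.erase x, β i) := Nat.mul_le_mul_left _ hW
        _ = w * ((v + 1) * ∑ i ∈ U.erase x, β i) := by ring
        _ ≤ w * (v * ∑ i ∈ U, β i) := Nat.mul_le_mul_left _ h
        _ = v * (w * ∑ i ∈ U, β i) := by ring

theorem VectorCode.IsMDS.eq_of_agree {F : Type*} [Field F] {n k α : ℕ} {C : VectorCode F n k α}
    (hC : C.IsMDS) {S : Finset (Fin n)} (hS : k ≤ S.card) {m m' : Fin k → Fin α → F}
    (h : ∀ i ∈ S, C m i = C m' i) : m = m' := by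
  obtain ⟨S', hS', hc⟩ := Finset.exists_subset_card_eq hS
  exact hC S' hc m m' fun i hi => h i (hS' hi)

/-- In an MDS code, if a code symbol `e` can be computed from other symbols and `w` elements
of `F`, the other symbols being fewer than the dimension, then `α ≤ w`. -/
theorem VectorCode.IsMDS.le_of_recover {F : Type*} [Field F] [Finite F] {n k α w : ℕ}
    {C : VectorCode F n k α} (hC : C.IsMDS) {S : Finset (Fin n)} (hS : S.card = k) {e : Fin n}
    (he : e ∈ S) (g : (Fin k → Fin α → F) → Fin w → F)
    (hg : ∀ m m', (∀ i ∈ S.erase e, C m i = C m' i) → g m = g m' → C m e = C m' e) : α ≤ w := by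
  classical
  have hinj : Function.Injective fun m : Fin k → Fin α → F =>
      (Sum.elim (fun p => C m p.1.1 p.2) (g m) : (S.erase e × Fin α) ⊕ Fin w → F) := by
    intro m m' h
    have h1 : ∀ i ∈ S.erase e, C m i = C m' i := fun i hi =>
      funext fun t => congrFun h (Sum.inl (⟨i, hi⟩, t))
    have h2 : g m = g m' := funext fun t => congrFun h (Sum.inr t)
    refine hC S hS m m' fun i hi => ?_
    by_cases hie : i = e
    · exact hie ▸ hg m m' h1 h2
    · exact h1 i (Finset.mem_erase.2 ⟨hie, hi⟩)
  have h := mul_le_card_of_injective hinj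
  have hk : 0 < k := hS ▸ Finset.card_pos.2 ⟨e, he⟩
  obtain ⟨k, rfl⟩ : ∃ k', k = k' + 1 := ⟨k - 1, by omega⟩
  simp only [Fintype.card_sum, Fintype.card_prod, Fintype.card_coe, Fintype.card_fin,
    Finset.card_erase_of_mem he, hS, Nat.add_sub_cancel] at h
  nlinarith

theorem mergeMessages_injective {A : Type*} {lam k : ℕ} :
    Function.Injective (mergeMessages : (Fin lam → Fin k → A) → Fin (lam * k) → A) := by
  intro m m' h
  funext ℓ i
  simpa [mergeMessages] using congrFun h (finProdFinEquiv (ℓ, i))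

theorem mergeMessages_surjective {A : Type*} {lam k : ℕ} :
    Function.Surjective (mergeMessages : (Fin lam → Fin k → A) → Fin (lam * k) → A) := fun M =>
  ⟨fun ℓ i => M (finProdFinEquiv (ℓ, i)), by
    funext j
    simp only [mergeMessages, Prod.mk.eta, Equiv.apply_symm_apply]⟩

/-! ### Lower bound on the bandwidth cost -/

namespace MDSConvertibleCode

section
variable {F : Type*} [Field F] {lam k rI rF α : ℕ} (C : MDSConvertibleCode F lam k rI rF α)

/-- The unchanged disks of the initial codeword `ℓ`. -/
def unchangedIn (ℓ : Fin lam) : Finset (Fin (k + rI)) :=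
  Finset.univ.filter fun i => (ℓ, i) ∈ C.unchanged

/-- The number of elements of `F` downloaded from the disks of the initial codeword `ℓ`. -/
def readIn (ℓ : Fin lam) : ℕ := ∑ i, C.readAmount (ℓ, i)

theorem mem_unchangedIn {ℓ : Fin lam} {i : Fin (k + rI)} :
    i ∈ C.unchangedIn ℓ ↔ (ℓ, i) ∈ C.unchanged := by simp [unchangedIn]

theorem readBandwidth_eq_sum : C.readBandwidth = ∑ ℓ, C.readIn ℓ := by
  simp only [readBandwidth, readIn, Fintype.sum_prod_type]

theorem card_unchanged_eq_sum : C.unchanged.card = ∑ ℓ, (C.unchangedIn ℓ).card := by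
  have : ∀ ℓ : Fin lam, (C.unchangedIn ℓ).card =
      ∑ i : Fin (k + rI), if (ℓ, i) ∈ C.unchanged then 1 else 0 := fun ℓ => by
    rw [unchangedIn, Finset.card_filter]
  simp only [this]
  rw [← Fintype.sum_prod_type (fun d => if d ∈ C.unchanged then 1 else 0)]
  simp

theorem card_newDisks_add_card_unchanged :
    C.newDisks.card + C.unchanged.card = lam * k + rF := by
  have h := Finset.card_compl_add_card (Finset.univ.map C.place)
  simpa [newDisks] using h

theorem mem_newDisks {e : Fin (lam * k + rF)} : e ∈ C.newDisks ↔ e ∉ Set.range C.place := by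
  simp [newDisks]

variable [Finite F]

/-- The other `lam * k - 1` symbols of an information set leave this symbol completely free, so what
is sent must carry all of it. -/
theorem le_writeAmount (hK : 0 < lam * k) {e : Fin (lam * k + rF)} (he : e ∈ C.newDisks) :
    α ≤ C.writeAmount e := by
  obtain ⟨S, heS, hS⟩ : ∃ S : Finset (Fin (lam * k + rF)), {e} ⊆ S ∧ S.card = lam * k :=
    Finset.exists_superset_card_eq (by simp; omega) (by simp)
  rw [Finset.singleton_subset_iff] at heS
  choose split hsplit using mergeMessages_surjective (A := Fin α → F) (lam := lam) (k := k)
  refine C.final_mds.le_of_recover hS heS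
    (fun M => C.send e fun d => C.download d (C.initial (split M d.1) d.2)) fun M M' _ hg => ?_
  rw [← hsplit M, ← hsplit M', ← C.store_spec _ e (C.mem_newDisks.1 he),
    ← C.store_spec _ e (C.mem_newDisks.1 he)]
  exact congrArg _ hg

theorem card_newDisks_mul_le_writeBandwidth (hK : 0 < lam * k) :
    C.newDisks.card * α ≤ C.writeBandwidth := by
  simpa [writeBandwidth] using Finset.card_nsmul_le_sum C.newDisks C.writeAmount α
    fun e he => C.le_writeAmount hK he

/-- At most `k` disks of an initial codeword can be unchanged, since more than `k` symbols are
dependent in the initial code. -/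
theorem card_unchangedIn_le (hlam : 2 ≤ lam) (hk : 0 < k) (hα : 0 < α) (ℓ : Fin lam) :
    (C.unchangedIn ℓ).card ≤ k := by
  classical
  by_contra! hlt
  obtain ⟨V, hVU, hV⟩ := Finset.exists_subset_card_eq (show k + 1 ≤ (C.unchangedIn ℓ).card from hlt)
  obtain ⟨x, hx⟩ : V.Nonempty := Finset.card_pos.1 (by omega)
  let pl : V ↪ Fin (lam * k + rF) :=
    ⟨fun i => C.place ⟨(ℓ, i.1), C.mem_unchangedIn.1 (hVU i.2)⟩, fun i j h => by
      have := C.place.injective h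
      exact Subtype.ext (congrArg (fun d => d.1.2) this)⟩
  -- Here `2 ≤ lam` matters: `k + 1 ≤ lam * k`, so these symbols are independent in the final code.
  obtain ⟨S, hVS, hS⟩ : ∃ S : Finset (Fin (lam * k + rF)),
      Finset.univ.map pl ⊆ S ∧ S.card = lam * k :=
    Finset.exists_superset_card_eq (by simp [hV]; nlinarith) (by simp)
  have hmem : ∀ i : V, pl i ∈ S := fun i => hVS (by simp)
  refine absurd (C.final_mds.le_of_recover hS (hmem ⟨x, hx⟩) (w := 0) (fun _ => Fin.elim0)
    fun M M' h _ => ?_) (by omega)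
  obtain ⟨m, rfl⟩ := mergeMessages_surjective M
  obtain ⟨m', rfl⟩ := mergeMessages_surjective M'
  have hpl : ∀ (m : Fin lam → Fin k → Fin α → F) (i : V),
      C.final (mergeMessages m) (pl i) = C.initial (m ℓ) i := fun m i => C.place_spec m _
  have : m ℓ = m' ℓ := C.initial_mds (V.erase x) (by rw [Finset.card_erase_of_mem hx, hV]; rfl) _ _
    fun i hi => by
      obtain ⟨hix, hiV⟩ := Finset.mem_erase.1 hi
      rw [← hpl m ⟨i, hiV⟩, ← hpl m' ⟨i, hiV⟩]
      exact h _ (Finset.mem_erase.2 ⟨fun h => hix (congrArg Subtype.val (pl.injective h)), hmem _⟩)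
  rw [hpl, hpl, this]

/-- The information-theoretic bound: knowing the content of the disks in `A` of an initial
codeword, the downloads from the others must determine the codeword, provided that `A` misses at
most `rF` unchanged disks. -/
theorem mul_le_sum_ite_readAmount (ℓ : Fin lam) (A : Finset (Fin (k + rI)))
    (hA : (C.unchangedIn ℓ \ A).card ≤ rF) :
    k * α ≤ ∑ i, if i ∈ A then α else C.readAmount (ℓ, i) := by
  classical
  have hinj : Function.Injective fun m : Fin k → Fin α → F =>
      (Sum.elim (fun p => C.initial m p.1.1 p.2)
        (fun p => C.download (ℓ, p.1.1) (C.initial m p.1.1) p.2) :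
        (A × Fin α) ⊕ (Σ i : (Aᶜ : Finset (Fin (k + rI))), Fin (C.readAmount (ℓ, i.1))) → F) := by
    intro m m' h
    have h1 : ∀ i ∈ A, C.initial m i = C.initial m' i := fun i hi =>
      funext fun t => congrFun h (Sum.inl (⟨i, hi⟩, t))
    have h2 : ∀ i, C.download (ℓ, i) (C.initial m i) = C.download (ℓ, i) (C.initial m' i) := by
      intro i
      by_cases hi : i ∈ A
      · rw [h1 i hi]
      · exact funext fun t => congrFun h (Sum.inr ⟨⟨i, Finset.mem_compl.2 hi⟩, t⟩)
    -- All other codewords are zero, so two extensions can differ only in codeword `ℓ`.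
    let ext (m : Fin k → Fin α → F) : Fin lam → Fin k → Fin α → F := Function.update 0 ℓ m
    have hself : ∀ m, ext m ℓ = m := fun m => Function.update_self ..
    have hne : ∀ {ℓ'}, ℓ' ≠ ℓ → ext m ℓ' = ext m' ℓ' := fun h => by
      simp only [ext, Function.update_of_ne h]
    have hdown : ∀ d : Fin lam × Fin (k + rI),
        C.download d (C.initial (ext m d.1) d.2) = C.download d (C.initial (ext m' d.1) d.2) := by
      rintro ⟨ℓ', i⟩
      by_cases hℓ : ℓ' = ℓ
      · subst hℓ
        simpa only [hself] using h2 i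
      · simp only [hne hℓ]
    let pl : (C.unchangedIn ℓ \ A : Finset _) → Fin (lam * k + rF) := fun i =>
      C.place ⟨(ℓ, i.1), C.mem_unchangedIn.1 (Finset.mem_sdiff.1 i.2).1⟩
    have hcard : lam * k ≤ ((Finset.univ.image pl)ᶜ).card := by
      have h3 := Finset.card_compl_add_card (Finset.univ.image pl)
      have h4 := (Finset.card_image_le (s := Finset.univ) (f := pl))
      simp only [Fintype.card_fin, Finset.card_univ, Fintype.card_coe] at h3 h4
      omega
    have hmerge : mergeMessages (ext m) = mergeMessages (ext m') := by
      refine C.final_mds.eq_of_agree hcard fun e he => ?_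
      by_cases hr : e ∈ Set.range C.place
      · obtain ⟨⟨⟨ℓ', i⟩, hd⟩, rfl⟩ := hr
        rw [C.place_spec, C.place_spec]
        by_cases hℓ : ℓ' = ℓ
        · subst hℓ
          simp only [hself]
          by_cases hi : i ∈ A
          · exact h1 i hi
          · refine absurd (Finset.mem_image_of_mem pl (Finset.mem_univ
              ⟨i, Finset.mem_sdiff.2 ⟨C.mem_unchangedIn.2 hd, hi⟩⟩)) (Finset.mem_compl.1 he)
        · simp only [hne hℓ]
      · rw [← C.store_spec _ e hr, ← C.store_spec _ e hr]
        simp only [hdown]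
    have := congrFun (mergeMessages_injective hmerge) ℓ
    rwa [hself, hself] at this
  have h := mul_le_card_of_injective hinj
  simp only [Fintype.card_sum, Fintype.card_prod, Fintype.card_coe, Fintype.card_fin,
    Fintype.card_sigma, Finset.sum_coe_sort Aᶜ (fun i => C.readAmount (ℓ, i))] at h
  rwa [Finset.sum_ite, Finset.sum_const, smul_eq_mul, Finset.filter_univ_mem,
    Finset.filter_notMem_eq_sdiff, ← Finset.compl_eq_univ_sdiff]

/-- The amount of data read from an initial codeword with `u` unchanged disks, in terms of the
number `w ≤ min u rF` of unchanged disks whose content is disregarded. -/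
theorem mul_le_mul_readIn_add (ℓ : Fin lam) {w : ℕ} (hw : w ≤ (C.unchangedIn ℓ).card)
    (hwF : w ≤ rF) :
    w * ((k + rI) * α) ≤ w * C.readIn ℓ + (C.unchangedIn ℓ).card * (rI * α) := by
  classical
  set U := C.unchangedIn ℓ with hU
  let β := fun i => C.readAmount (ℓ, i)
  obtain ⟨W, hWU, hWc, hW⟩ := U.exists_subset_card_mul_sum_le β hw
  -- A disk may send more than `α` elements. Counting such a retired disk by its content makes every
  -- retired disk contribute `min α (β i)`.
  have key := C.mul_le_sum_ite_readAmount ℓ ((U \ W) ∪ Uᶜ.filter fun i => α < β i) (by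
    refine (Finset.card_le_card (t := W) fun i hi => ?_).trans (hWc.trans_le hwF)
    simp only [Finset.mem_sdiff, Finset.mem_union, Finset.mem_filter, Finset.mem_compl, ← hU] at hi
    tauto)
  rw [← Finset.sum_add_sum_compl U] at key
  have h1 : ∑ i ∈ U, (if i ∈ (U \ W) ∪ Uᶜ.filter (fun i => α < β i) then α
      else C.readAmount (ℓ, i)) = (U.card - w) * α + ∑ i ∈ W, β i := by
    rw [← Finset.sum_sdiff hWU, ← hWc, ← Finset.card_sdiff_of_subset hWU, ← smul_eq_mul,
      ← Finset.sum_const]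
    congr 1
    · exact Finset.sum_congr rfl fun i hi => by simp [Finset.mem_sdiff.1 hi]
    · exact Finset.sum_congr rfl fun i hi => by simp [hi, hWU hi, β]
  have h2 : ∑ i ∈ Uᶜ, (if i ∈ (U \ W) ∪ Uᶜ.filter (fun i => α < β i) then α
      else C.readAmount (ℓ, i)) = ∑ i ∈ Uᶜ, min α (β i) := by
    refine Finset.sum_congr rfl fun i hi => ?_
    have := Finset.mem_compl.1 hi
    simp only [Finset.mem_union, Finset.mem_sdiff, this, false_and, Finset.mem_filter, hi, true_and,
      false_or]
    grind
  have h3 : ∑ i ∈ Uᶜ, min α (β i) + U.card * α ≤ (k + rI) * α := by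
    have h := Finset.sum_le_card_nsmul Uᶜ (fun i => min α (β i)) α fun i _ => min_le_left _ _
    have hc := Finset.card_compl_add_card U
    rw [Fintype.card_fin] at hc
    rw [smul_eq_mul] at h
    have hm := congrArg (· * α) hc
    simp only [add_mul] at hm ⊢
    linarith
  have h4 : ∑ i ∈ Uᶜ, min α (β i) + ∑ i ∈ U, β i ≤ C.readIn ℓ := by
    rw [readIn, ← Finset.sum_compl_add_sum U]
    exact Nat.add_le_add_right (Finset.sum_le_sum fun i _ => min_le_right _ _) _
  rw [h1, h2] at key
  obtain ⟨v, hv⟩ := Nat.exists_eq_add_of_le hw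
  rw [hv] at hW h3 key ⊢
  rw [Nat.add_sub_cancel_left] at key
  generalize ∑ i ∈ Uᶜ, min α (β i) = R at *
  generalize ∑ i ∈ U, β i = X at *
  generalize ∑ i ∈ W, β i = Y at *
  generalize C.readIn ℓ = T at *
  -- With `u = w + v`, split `u * R = w * R + v * R`: the first part joins `w * X` inside `w * T`,
  -- the second is bounded by `h3`.
  have k1 := Nat.mul_le_mul_left (w + v) key
  have k3 := Nat.mul_le_mul_left v h3
  have k4 := Nat.mul_le_mul_left w h4
  nlinarith

/-- The bound on the read bandwidth of an initial codeword, with a penalty for the disks that are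
retired without need. -/
theorem le_readIn (hlam : 2 ≤ lam) (hI : rI < rF) (hF : rF < k) (hα : 0 < α) (ℓ : Fin lam) :
    rF * ((k + rI) * α) + rF * α * (C.unchangedIn ℓ).card ≤
        rF * C.readIn ℓ + k * (rI * α) + rF * α * k ∧
      ((C.unchangedIn ℓ).card ≠ k →
        rF * ((k + rI) * α) + rF * α * (C.unchangedIn ℓ).card <
          rF * C.readIn ℓ + k * (rI * α) + rF * α * k) := by
  have hu := C.card_unchangedIn_le hlam (by omega) hα ℓ
  set u := (C.unchangedIn ℓ).card with hu_def
  obtain ⟨v, hv⟩ := Nat.exists_eq_add_of_le hu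
  have hstrict : u ≠ k → 0 < v * α := fun h => Nat.mul_pos (by omega) hα
  -- The slack `v * α`, for `v` disks retired without need, gives both the bound and its strictness.
  suffices h : rF * ((k + rI) * α) + rF * α * u + v * α ≤
      rF * C.readIn ℓ + k * (rI * α) + rF * α * k from
    ⟨by omega, fun h' => by have := hstrict h'; omega⟩
  have hFv : v * α ≤ rF * (v * α) := Nat.le_mul_of_pos_left _ (by omega)
  have hkF : rF * α * k = rF * α * u + rF * (v * α) := by
    conv_lhs => rw [hv]
    ring
  have hkI : k * (rI * α) = u * (rI * α) + v * (rI * α) := by rw [← add_mul, ← hv]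
  rcases le_total rF u with h | h
  · have := C.mul_le_mul_readIn_add ℓ h le_rfl
    rw [← hu_def] at this
    linarith [Nat.zero_le (v * (rI * α))]
  -- With at most `rF` unchanged disks, all of them can be disregarded: the downloads alone
  -- determine the codeword.
  · have hk := C.mul_le_sum_ite_readAmount ℓ ∅ (by simpa [← hu_def] using h)
    simp only [Finset.notMem_empty, if_false] at hk
    change k * α ≤ C.readIn ℓ at hk
    have h1 := Nat.mul_le_mul_left rF hk
    have h2 : rF * (rI * α) ≤ k * (rI * α) := Nat.mul_le_mul_right _ hF.le
    rw [add_mul, mul_add]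
    linarith

/-- The write bandwidth is at least that of rewriting all but the unchanged final symbols. -/
theorem readBandwidth_add_le_bandwidthCost (hlam : 2 ≤ lam) (hF : rF < k) :
    rF * C.readBandwidth + lam * (k * (rI * α)) + rF * α * (lam * k) + rF * (rF * α) ≤
      rF * C.bandwidthCost + lam * (k * (rI * α)) + rF * α * C.unchanged.card := by
  have hw := Nat.mul_le_mul_left rF
    (C.card_newDisks_mul_le_writeBandwidth (Nat.mul_pos (by omega) (by omega)))
  have hc := congrArg (rF * α * ·) C.card_newDisks_add_card_unchanged
  simp only [bandwidthCost] at hc ⊢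
  nlinarith

/-- The lower bound on the bandwidth cost. -/
theorem le_bandwidthCost (hlam : 2 ≤ lam) (hI : rI < rF) (hF : rF < k) (hα : 0 < α) :
    lam * (rF * ((k + rI) * α)) + rF * (rF * α) ≤
      rF * C.bandwidthCost + lam * (k * (rI * α)) := by
  have h := Finset.sum_le_sum fun ℓ (_ : ℓ ∈ Finset.univ) => (C.le_readIn hlam hI hF hα ℓ).1
  simp only [Finset.sum_add_distrib, ← Finset.mul_sum, ← C.readBandwidth_eq_sum,
    ← C.card_unchanged_eq_sum, Finset.sum_const, Finset.card_univ, Fintype.card_fin,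
    smul_eq_mul] at h
  have := C.readBandwidth_add_le_bandwidthCost hlam hF
  nlinarith

/-- In case of equality in the lower bound, every initial codeword has `k` unchanged disks, and the
bound holds with equality for every initial codeword. -/
theorem card_unchangedIn_and_readIn_of_bandwidthCost_le (hlam : 2 ≤ lam) (hI : rI < rF)
    (hF : rF < k) (hα : 0 < α)
    (hC : rF * C.bandwidthCost + lam * (k * (rI * α)) ≤
      lam * (rF * ((k + rI) * α)) + rF * (rF * α)) (ℓ : Fin lam) :
    (C.unchangedIn ℓ).card = k ∧ rF * C.readIn ℓ + k * (rI * α) = rF * ((k + rI) * α) := by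
  have hle := fun ℓ (_ : ℓ ∈ Finset.univ) => (C.le_readIn hlam hI hF hα ℓ).1
  have hsum : ∑ ℓ, (rF * ((k + rI) * α) + rF * α * (C.unchangedIn ℓ).card) =
      ∑ ℓ, (rF * C.readIn ℓ + k * (rI * α) + rF * α * k) := by
    refine le_antisymm (Finset.sum_le_sum hle) ?_
    simp only [Finset.sum_add_distrib, ← Finset.mul_sum, ← C.readBandwidth_eq_sum,
      ← C.card_unchanged_eq_sum, Finset.sum_const, Finset.card_univ, Fintype.card_fin,
      smul_eq_mul]
    have := C.readBandwidth_add_le_bandwidthCost hlam hF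
    nlinarith
  have heq := (Finset.sum_eq_sum_iff_of_le hle).1 hsum ℓ (Finset.mem_univ ℓ)
  have hu : (C.unchangedIn ℓ).card = k := by
    by_contra hne
    exact absurd heq ((C.le_readIn hlam hI hF hα ℓ).2 hne).ne
  rw [hu] at heq
  exact ⟨hu, by omega⟩

/-- A code with uniform download that attains the lower bound has a sub-packetization divisible
enough for the common download to be an integer. -/
theorem dvd_of_bandwidthCost_le (hlam : 2 ≤ lam) (hI : rI < rF)
    (hF : rF < k) (hα : 0 < α)
    (hC : rF * C.bandwidthCost + lam * (k * (rI * α)) ≤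
      lam * (rF * ((k + rI) * α)) + rF * (rF * α)) (hU : C.HasUniformDownload) :
    rF ∣ α * rI := by
  classical
  obtain ⟨hu, hr⟩ := C.card_unchangedIn_and_readIn_of_bandwidthCost_le hlam hI hF hα hC
    ⟨0, by omega⟩
  set ℓ : Fin lam := ⟨0, by omega⟩
  obtain ⟨x, hx⟩ : (C.unchangedIn ℓ).Nonempty := Finset.card_pos.1 (by omega)
  have hT : C.readIn ℓ = k * C.readAmount (ℓ, x) + rI * α := by
    rw [readIn, ← Finset.sum_add_sum_compl (C.unchangedIn ℓ),
      Finset.sum_congr rfl fun i hi => hU.1 (ℓ, i) (C.mem_unchangedIn.1 hi) (ℓ, x)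
        (C.mem_unchangedIn.1 hx),
      Finset.sum_congr (s₁ := (C.unchangedIn ℓ)ᶜ) rfl fun i hi =>
        (hU.2 (ℓ, i) fun h => Finset.mem_compl.1 hi (C.mem_unchangedIn.2 h)).1]
    simp [Finset.card_compl, hu]
  rw [hT] at hr
  -- Divide the equality for codeword `ℓ` by `k`; two of the three terms are multiples of `rF`.
  have : rF * C.readAmount (ℓ, x) + α * rI = rF * α := by
    refine Nat.eq_of_mul_eq_mul_left (show 0 < k by omega) ?_
    linarith
  exact (Nat.dvd_add_right (Dvd.intro _ rfl)).1 (this ▸ Dvd.intro _ rfl)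

end

end MDSConvertibleCode

/-! ### Superregular matrices over prime fields -/

/-- The number of sign variations of a nonzero polynomial is less than its number of terms. -/
theorem Polynomial.signVariations_lt_card_support {R : Type*} [Ring R] [LinearOrder R]
    {P : Polynomial R} (hP : P ≠ 0) : P.signVariations < P.support.card := by
  induction hn : P.support.card generalizing P with
  | zero => simp_all
  | succ n ih =>
    have hle := Polynomial.signVariations_le_eraseLead_succ (P := P)
    have hc : P.eraseLead.support.card = n := Polynomial.card_support_eraseLead' hn
    by_cases h0 : P.eraseLead = 0
    · have := P.eraseLead_add_monomial_natDegree_leadingCoeff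
      rw [h0, zero_add] at this
      rw [← this, Polynomial.signVariations_monomial]
      omega
    · have := ih h0 hc
      omega

/-- A generalized Vandermonde determinant at distinct positive points does not vanish. -/
theorem Matrix.det_of_pow_ne_zero {s : ℕ} {x : Fin s → ℤ} (hx : Function.Injective x)
    (hpos : ∀ c, 0 < x c) {e : Fin s → ℕ} (he : Function.Injective e) :
    (Matrix.of fun j c => x c ^ e j).det ≠ 0 := by
  classical
  intro hdet
  obtain ⟨v, hv, hv0⟩ := Matrix.exists_vecMul_eq_zero_iff.2 hdet
  -- A left kernel vector gives a polynomial with at most `s` terms and `s` distinct positive roots,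
  -- against Descartes' rule.
  let P : Polynomial ℤ := ∑ j, Polynomial.monomial (e j) (v j)
  have hcoeff : ∀ j, P.coeff (e j) = v j := fun j => by
    simp [P, Polynomial.coeff_monomial, he.eq_iff]
  have hP : P ≠ 0 := fun h => hv (funext fun j => by rw [← hcoeff, h]; simp)
  have hroot : ∀ c, P.eval (x c) = 0 := fun c => by
    have := congrFun hv0 c
    simpa [P, Polynomial.eval_finsetSum, Matrix.vecMul, dotProduct] using this
  have hsupp : P.support.card ≤ s := by
    have : P.support ⊆ Finset.univ.image e := fun n hn => by
      by_contra hne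
      refine Polynomial.mem_support_iff.1 hn ?_
      simp only [Finset.mem_image, Finset.mem_univ, true_and, not_exists] at hne
      simp [P, Polynomial.coeff_monomial, hne]
    exact (Finset.card_le_card this).trans (Finset.card_image_le.trans (by simp))
  have hcount : s ≤ P.roots.countP (0 < ·) := by
    have hsub : (Finset.univ.map ⟨x, hx⟩).val ≤ P.roots.filter (0 < ·) := by
      refine (Multiset.le_iff_subset (Finset.nodup _)).2 fun a ha => ?_
      obtain ⟨c, -, rfl⟩ := Finset.mem_map.1 (Finset.mem_def.2 ha)
      exact Multiset.mem_filter.2 ⟨(Polynomial.mem_roots hP).2 (hroot c), hpos c⟩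
    have := Multiset.card_le_card hsub
    rw [← Multiset.countP_eq_card_filter] at this
    simpa using this
  have h1 := P.roots_countP_pos_le_signVariations
  have h2 := Polynomial.signVariations_lt_card_support hP
  omega

/-- A matrix is superregular if all its square submatrices are nonsingular. -/
def Matrix.IsSuperregular {R C A : Type*} [CommRing A] (M : Matrix R C A) : Prop :=
  ∀ (s : ℕ) (f : Fin s ↪ R) (g : Fin s ↪ C), (M.submatrix f g).det ≠ 0

/-- A superregular integer matrix remains superregular modulo some prime. -/
theorem Matrix.IsSuperregular.exists_prime {R C : Type*} [Fintype R] [Fintype C]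
    {M : Matrix R C ℤ} (hM : M.IsSuperregular) :
    ∃ p, p.Prime ∧ (M.map (Int.cast : ℤ → ZMod p)).IsSuperregular := by
  classical
  let D : (Σ s : Fin (Fintype.card R + 1), (Fin s ↪ R) × (Fin s ↪ C)) → ℤ :=
    fun i => (M.submatrix i.2.1 i.2.2).det
  -- A prime exceeding every minor in absolute value divides none of them.
  obtain ⟨p, hple, hp⟩ := Nat.exists_infinite_primes (∑ i, (D i).natAbs + 1)
  refine ⟨p, hp, fun s f g hdet => ?_⟩
  have hs : s < Fintype.card R + 1 := by
    have := Fintype.card_le_of_embedding f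
    rw [Fintype.card_fin] at this
    omega
  have h0 : ((D ⟨⟨s, hs⟩, f, g⟩ : ℤ) : ZMod p) = 0 := by
    rw [← hdet]
    exact (Int.castRingHom (ZMod p)).map_det _
  have hle : (D ⟨⟨s, hs⟩, f, g⟩).natAbs ≤ ∑ i, (D i).natAbs :=
    Finset.single_le_sum (f := fun i => (D i).natAbs) (fun _ _ => Nat.zero_le _) (Finset.mem_univ _)
  have hdvd := Int.natAbs_dvd_natAbs.2 ((ZMod.intCast_zmod_eq_zero_iff_dvd _ p).1 h0)
  rw [Int.natAbs_natCast] at hdvd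
  refine hM s f g (Int.natAbs_eq_zero.1 (Nat.eq_zero_of_dvd_of_lt hdvd ?_))
  change (D ⟨⟨s, hs⟩, f, g⟩).natAbs < p
  omega

/-- Erasure decoding: the rows in `B` form a square nonsingular system in the unknowns indexed by
`T`. -/
theorem Matrix.IsSuperregular.eq_zero {R C F : Type*} [Fintype C] [Field F]
    {M : Matrix R C F} (hM : M.IsSuperregular) {x : C → F} (T : Finset C) (B : Finset R)
    (hTB : T.card = B.card) (hT : ∀ c ∉ T, x c = 0) (hB : ∀ j ∈ B, M.mulVec x j = 0) : x = 0 := by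
  classical
  let g : Fin T.card ↪ C := T.equivFin.symm.toEmbedding.trans (Function.Embedding.subtype _)
  let f : Fin T.card ↪ R :=
    (B.equivFinOfCardEq hTB.symm).symm.toEmbedding.trans (Function.Embedding.subtype _)
  have hx : x ∘ g = 0 := by
    refine Matrix.eq_zero_of_mulVec_eq_zero (hM _ f g) (funext fun j => ?_)
    have hj := hB (f j) ((B.equivFinOfCardEq hTB.symm).symm j).2
    rw [Matrix.mulVec, dotProduct, ← Finset.sum_subset (Finset.subset_univ T)
      (fun c _ hc => by rw [hT c hc, mul_zero]), ← Finset.sum_coe_sort T,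
      ← T.equivFin.symm.sum_comp] at hj
    exact hj
  funext c
  by_cases hc : c ∈ T
  · have := congrFun hx (T.equivFin ⟨c, hc⟩)
    simpa [g] using this
  · exact hT c hc

/-- A systematic code with superregular parity part is MDS. -/
theorem Matrix.IsSuperregular.eq_zero_of_card {k r : ℕ} {F : Type*} [Field F]
    {M : Matrix (Fin r) (Fin k) F} (hM : M.IsSuperregular) {x : Fin k → F}
    {S : Finset (Fin (k + r))} (hS : S.card = k)
    (h1 : ∀ c, Fin.castAdd r c ∈ S → x c = 0) (h2 : ∀ j, Fin.natAdd k j ∈ S → M.mulVec x j = 0) :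
    x = 0 := by
  classical
  let S' := S.map finSumFinEquiv.symm.toEmbedding
  have hmem : ∀ y, y ∈ S' ↔ finSumFinEquiv y ∈ S := fun y => by
    simp [S', Finset.mem_map_equiv]
  -- Hence there are as many missing data symbols as available parities.
  have hc : S'.toLeft.card + S'.toRight.card = k := by
    rw [Finset.card_toLeft_add_card_toRight, Finset.card_map, hS]
  refine hM.eq_zero S'.toLeftᶜ S'.toRight ?_ (fun c hc => h1 c ?_) (fun j hj => h2 j ?_)
  · rw [Finset.card_compl, Fintype.card_fin]
    omega
  · rw [Finset.mem_compl, not_not, Finset.mem_toLeft, hmem] at hc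
    simpa using hc
  · rw [Finset.mem_toRight, hmem] at hj
    simpa using hj

/-! ### Piggybacked codes and the optimal construction -/

/-- The systematic vector code with parity matrix `M` in every layer, in which the parity symbol
`j` has piggybacked onto its layer `t` the combination `G j t` of the data in layer `τ j t`. -/
def piggybackedCode {F : Type*} [Field F] {k r α : ℕ} (M : Matrix (Fin r) (Fin k) F)
    (G : Fin r → Fin α → Fin k → F) (τ : Fin r → Fin α → Fin α) : VectorCode F (k + r) k α where
  toFun m := Fin.append m fun j t =>
    M.mulVec (fun i => m i t) j + dotProduct (G j t) fun i => m i (τ j t)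
  map_add' m m' := by
    funext e t
    refine Fin.addCases (fun i => ?_) (fun j => ?_) e
    · simp
    · simp [Matrix.mulVec, dotProduct, mul_add, Finset.sum_add_distrib]
      ring
  map_smul' a m := by
    funext e t
    refine Fin.addCases (fun i => ?_) (fun j => ?_) e
    · simp
    · simp [Matrix.mulVec, dotProduct, mul_add, Finset.mul_sum, mul_left_comm]

section
variable {F : Type*} [Field F] {k r α : ℕ} {M : Matrix (Fin r) (Fin k) F}
  {G : Fin r → Fin α → Fin k → F} {τ : Fin r → Fin α → Fin α}

@[simp] theorem piggybackedCode_castAdd (m : Fin k → Fin α → F) (i : Fin k) :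
    piggybackedCode M G τ m (Fin.castAdd r i) = m i := by
  simp [piggybackedCode]

theorem piggybackedCode_natAdd (m : Fin k → Fin α → F) (j : Fin r) (t : Fin α) :
    piggybackedCode M G τ m (Fin.natAdd k j) t =
      M.mulVec (fun i => m i t) j + dotProduct (G j t) fun i => m i (τ j t) := by
  simp [piggybackedCode]

/-- A piggybacked code with superregular parity matrix is MDS if only layers below `β` carry
piggybacks, and these come from layers that carry none. -/
theorem piggybackedCode_isMDS (hM : M.IsSuperregular) (β : ℕ)
    (hG : ∀ j t, G j t = 0 ∨ (t < β ∧ β ≤ τ j t)) : (piggybackedCode M G τ).IsMDS := by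
  intro S hS m m' h
  suffices hx : ∀ t, (fun i => (m - m') i t) = 0 by
    funext i t
    exact sub_eq_zero.1 (congrFun (hx t) i)
  have h0 : ∀ e ∈ S, piggybackedCode M G τ (m - m') e = 0 := fun e he => by
    rw [map_sub, Pi.sub_apply, h e he, sub_self]
  generalize m - m' = x at h0
  have hdata : ∀ t c, Fin.castAdd r c ∈ S → x c t = 0 := fun t c hc => by
    have := h0 _ hc
    rw [piggybackedCode_castAdd] at this
    exact congrFun this t
  -- Decode the high layers first; their vanishing then removes the piggybacks from the low ones.
  have hhigh : ∀ t : Fin α, β ≤ t → (fun i => x i t) = 0 := fun t ht => by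
    refine hM.eq_zero_of_card hS (hdata t) fun j hj => ?_
    have := congrFun (h0 _ hj) t
    rw [piggybackedCode_natAdd, (hG j t).resolve_right (by omega)] at this
    simpa using this
  intro t
  refine hM.eq_zero_of_card hS (hdata t) fun j hj => ?_
  have := congrFun (h0 _ hj) t
  rw [piggybackedCode_natAdd] at this
  rcases hG j t with hz | ⟨-, hβ⟩
  · rw [hz] at this
    simpa using this
  · rw [hhigh _ hβ] at this
    simpa using this

end

/-- A bijective assignment of the piggyback positions: every pair of an additional parity
and a high layer is the source of the piggyback of some initial parity in some low layer. -/
theorem exists_piggyback_assignment {rI rF α β : ℕ} (hI : rI ≤ rF) (hβα : β ≤ α)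
    (hβ : rF * β + α * rI = rF * α) :
    ∃ f : Fin rI → Fin α → Option (Fin rF × Fin α),
      (∀ j t s, f j t = some s → (t : ℕ) < β ∧ β ≤ s.2) ∧
      ∀ (j : Fin rF) (t : Fin α), rI ≤ j → β ≤ t → ∃ j' t', f j' t' = some (j, t) := by
  classical
  obtain ⟨d, rfl⟩ := Nat.exists_eq_add_of_le hI
  obtain ⟨a, rfl⟩ := Nat.exists_eq_add_of_le hβα
  have hcard : rI * β = d * a := by nlinarith
  let e : Fin rI × Fin β ≃ Fin d × Fin a := Fintype.equivOfCardEq (by simpa using hcard)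
  refine ⟨fun j t => if h : (t : ℕ) < β then
    some (Fin.natAdd rI (e (j, ⟨t, h⟩)).1, Fin.natAdd β (e (j, ⟨t, h⟩)).2) else none, ?_, ?_⟩
  · intro j t s hs
    by_cases h : (t : ℕ) < β
    · simp only [h, dite_true, Option.some.injEq] at hs
      subst hs
      simp [h]
    · simp [h] at hs
  · intro j t hj ht
    refine ⟨(e.symm (⟨j - rI, by omega⟩, ⟨t - β, by omega⟩)).1,
      Fin.castAdd a (e.symm (⟨j - rI, by omega⟩, ⟨t - β, by omega⟩)).2, ?_⟩
    simp [hj, ht]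

/-- A superregular parity matrix of the final code whose blocks are row scalings of one matrix. -/
theorem exists_superregular_blocks (lam k r : ℕ) (hlam : 0 < lam) :
    ∃ (p : ℕ) (_ : Fact p.Prime) (M : Matrix (Fin r) (Fin (lam * k)) (ZMod p))
      (D : Fin lam → Fin r → ZMod p) (Q : Matrix (Fin r) (Fin k) (ZMod p)),
      M.IsSuperregular ∧ Q.IsSuperregular ∧
      ∀ ℓ i j, M j (finProdFinEquiv (ℓ, i)) = D ℓ j * Q j i := by
  have h : ∀ K, (Matrix.of fun (j : Fin r) (c : Fin K) =>
      ((2 : ℤ) ^ (c : ℕ)) ^ (j : ℕ)).IsSuperregular :=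
    fun K s f g => Matrix.det_of_pow_ne_zero (x := fun c => (2 : ℤ) ^ (g c : ℕ))
      (e := fun j => f j)
      (fun a b hab => g.injective (Fin.ext (Int.pow_right_injective (by norm_num) hab)))
      (fun c => by positivity) (fun a b hab => f.injective (Fin.ext hab))
  obtain ⟨p, hp, hM⟩ := (h (lam * k)).exists_prime
  -- The column index of `(ℓ, i)` is `i + k * ℓ`, so its power of 2 factors.
  refine ⟨p, ⟨hp⟩, _, fun ℓ j => ((2 : ZMod p) ^ (k * ℓ : ℕ)) ^ (j : ℕ),
    Matrix.of fun j i => ((2 : ZMod p) ^ (i : ℕ)) ^ (j : ℕ), hM, fun s f g hdet => ?_,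
    fun ℓ i j => ?_⟩
  -- `Q` is the block of the first `k` columns of `M`.
  · refine hM s f (g.trans (Fin.castLEEmb (Nat.le_mul_of_pos_left k hlam))) ?_
    convert hdet using 2
    ext j i
    simp
  · simp [finProdFinEquiv, pow_add, mul_pow, mul_comm]

theorem Matrix.IsSuperregular.submatrix_left {R R' C A : Type*} [CommRing A] {M : Matrix R C A}
    (hM : M.IsSuperregular) (e : R' ↪ R) : (M.submatrix e id).IsSuperregular :=
  fun s f g => hM s (f.trans e) g

/-- A final parity symbol is the sum of the scaled parities of the initial codewords. -/
theorem mulVec_mergeMessages {F : Type*} [Field F] {lam k r α : ℕ}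
    {M : Matrix (Fin r) (Fin (lam * k)) F} {D : Fin lam → Fin r → F} {Q : Matrix (Fin r) (Fin k) F}
    (hMQ : ∀ ℓ i j, M j (finProdFinEquiv (ℓ, i)) = D ℓ j * Q j i)
    (m : Fin lam → Fin k → Fin α → F) (j : Fin r) (t : Fin α) :
    M.mulVec (fun c => mergeMessages m c t) j =
      ∑ ℓ, D ℓ j * Q.mulVec (fun i => m ℓ i t) j := by
  simp only [Matrix.mulVec, dotProduct]
  rw [← finProdFinEquiv.sum_comp, Fintype.sum_prod_type]
  refine Finset.sum_congr rfl fun ℓ _ => ?_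
  rw [Finset.mul_sum]
  refine Finset.sum_congr rfl fun i _ => ?_
  rw [hMQ, mul_assoc]
  simp only [mergeMessages, Equiv.symm_apply_apply]

/-- The construction by piggybacking: download the layers below `β` of all data disks and the whole
content of all parity disks. -/
theorem exists_piggybacked_convertible_code {F : Type*} [Field F] {lam k rI rF α β : ℕ}
    (hI : rI ≤ rF) (hβα : β ≤ α) (hβ : rF * β + α * rI = rF * α)
    {M : Matrix (Fin rF) (Fin (lam * k)) F} {D : Fin lam → Fin rF → F}
    {Q : Matrix (Fin rF) (Fin k) F} (hM : M.IsSuperregular) (hQ : Q.IsSuperregular)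
    (hMQ : ∀ ℓ i j, M j (finProdFinEquiv (ℓ, i)) = D ℓ j * Q j i) :
    ∃ C : MDSConvertibleCode F lam k rI rF α,
      C.HasUniformDownload ∧ C.bandwidthCost = lam * (k * β + rI * α) + rF * α := by
  classical
  obtain ⟨f, hf, hfs⟩ := exists_piggyback_assignment hI hβα hβ
  -- The piggyback is a high-layer value of a parity that the initial code lacks; unassigned entries
  -- carry zero.
  let G : Fin rI → Fin α → Fin k → F := fun j t => (f j t).elim 0 fun s => Q s.1
  let τ : Fin rI → Fin α → Fin α := fun j t => (f j t).elim t Prod.snd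
  let I : VectorCode F (k + rI) k α :=
    piggybackedCode (Q.submatrix (Fin.castLEEmb hI) id) G τ
  let E : VectorCode F (lam * k + rF) (lam * k) α := piggybackedCode M 0 fun _ t => t
  let U : Finset (Fin lam × Fin (k + rI)) := Finset.univ.filter fun d => (d.2 : ℕ) < k
  have hU : ∀ {d}, d ∈ U ↔ (d.2 : ℕ) < k := by simp [U]
  let pl : U ↪ Fin (lam * k + rF) :=
    ⟨fun d => Fin.castAdd rF (finProdFinEquiv (d.1.1, ⟨d.1.2, hU.1 d.2⟩)), fun d d' h => by
      have h := finProdFinEquiv.injective (Fin.castAdd_injective _ _ h)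
      simp only [Prod.mk.injEq, Fin.mk.injEq] at h
      exact Subtype.ext (Prod.ext h.1 (Fin.ext h.2))⟩
  have hrange : ∀ e, e ∈ Set.range pl ↔ (e : ℕ) < lam * k := fun e => by
    refine ⟨?_, fun h => ?_⟩
    · rintro ⟨d, rfl⟩
      exact (finProdFinEquiv (d.1.1, ⟨d.1.2, hU.1 d.2⟩)).is_lt
    · refine ⟨⟨((finProdFinEquiv.symm ⟨e, h⟩).1, Fin.castAdd rI (finProdFinEquiv.symm ⟨e, h⟩).2),
        hU.2 (finProdFinEquiv.symm ⟨(e : ℕ), h⟩).2.is_lt⟩, Fin.ext ?_⟩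
      change ((finProdFinEquiv (finProdFinEquiv.symm ⟨e, h⟩) : Fin (lam * k)) : ℕ) = e
      rw [Equiv.apply_symm_apply]
  let b : Fin lam × Fin (k + rI) → ℕ := fun d => if (d.2 : ℕ) < k then β else α
  have hbα : ∀ d, b d ≤ α := fun d => by
    simp only [b]
    split_ifs <;> omega
  let dl : (d : Fin lam × Fin (k + rI)) → (Fin α → F) → Fin (b d) → F :=
    fun d s t => s (Fin.castLE (hbα d) t)
  have hdl : ∀ (m m' : Fin lam → Fin k → Fin α → F),
      (fun d => dl d (I (m d.1) d.2)) = (fun d => dl d (I (m' d.1) d.2)) →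
      ∀ j t, M.mulVec (fun c => mergeMessages m c t) j =
        M.mulVec (fun c => mergeMessages m' c t) j := by
    intro m m' h j t
    have hlow : ∀ ℓ (t : Fin α), (t : ℕ) < β → (fun i => m ℓ i t) = fun i => m' ℓ i t := by
      intro ℓ t ht
      funext i
      have hb : b (ℓ, Fin.castAdd rI i) = β := by simp [b]
      have := congrFun (congrFun h (ℓ, Fin.castAdd rI i)) ⟨t, ht.trans_eq hb.symm⟩
      simpa [dl, I] using this
    have hpar : ∀ ℓ j t, I (m ℓ) (Fin.natAdd k j) t = I (m' ℓ) (Fin.natAdd k j) t := by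
      intro ℓ j t
      have hb : b (ℓ, Fin.natAdd k j) = α := by simp [b]
      exact congrFun (congrFun h (ℓ, Fin.natAdd k j)) ⟨t, t.2.trans_eq hb.symm⟩
    simp only [I, piggybackedCode_natAdd] at hpar
    rw [mulVec_mergeMessages hMQ, mulVec_mergeMessages hMQ]
    refine Finset.sum_congr rfl fun ℓ _ => congrArg _ ?_
    -- Three sources: downloaded data, an initial parity without piggyback, or a piggyback freed by
    -- cancelling low-layer data.
    by_cases ht : (t : ℕ) < β
    · rw [hlow ℓ t ht]
    · by_cases hj : (j : ℕ) < rI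
      · have := hpar ℓ ⟨j, hj⟩ t
        have hn : f ⟨j, hj⟩ t = none :=
          Option.eq_none_iff_forall_ne_some.2 fun s hs => ht (hf _ _ _ hs).1
        simp only [G, τ, hn, Option.elim_none, zero_dotProduct, add_zero] at this
        exact this
      · obtain ⟨j', t', hs⟩ := hfs j t (by omega) (by omega)
        have := hpar ℓ j' t'
        rw [hlow ℓ t' (hf _ _ _ hs).1] at this
        simp only [G, τ, hs, Option.elim_some, add_right_inj] at this
        exact this
  -- Since the downloads determine each new symbol, a decoding function exists; its values off
  -- reachable downloads are irrelevant.
  have hfactor : ∀ j : Fin (lam * k + rF), ∃ g : ((d : Fin lam × Fin (k + rI)) → Fin (b d) → F) →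
      Fin α → F, j ∉ Set.range pl → ∀ m : Fin lam → Fin k → Fin α → F,
        g (fun d => dl d (I (m d.1) d.2)) = E (mergeMessages m) j := by
    intro e
    by_cases he : e ∈ Set.range pl
    · exact ⟨fun _ => 0, fun h => absurd he h⟩
    · have hft : Function.FactorsThrough
          (fun m : Fin lam → Fin k → Fin α → F => E (mergeMessages m) e)
          (fun m d => dl d (I (m d.1) d.2)) := by
        intro m m' h
        revert he
        refine Fin.addCases (fun c he => ?_) (fun j _ => ?_) e
        · exact absurd ((hrange _).2 (by simp)) he
        · funext t
          simpa [E, piggybackedCode_natAdd] using hdl m m' h j t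
      exact ⟨Function.extend _ _ 0, fun _ m => hft.extend_apply 0 m⟩
  choose g hg using hfactor
  let C : MDSConvertibleCode F lam k rI rF α :=
    { initial := I
      initial_mds := piggybackedCode_isMDS (hQ.submatrix_left _) β fun j t => by
        rcases h : f j t with _ | s
        · simp [G, h]
        · have := hf j t s h
          simp [G, τ, h, this]
      final := E
      final_mds := piggybackedCode_isMDS hM 0 fun j t => Or.inl rfl
      unchanged := U
      place := pl
      place_spec := fun m d => by
        obtain ⟨⟨ℓ, i⟩, hd⟩ := d
        change piggybackedCode M 0 _ (mergeMessages m)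
          (Fin.castAdd rF (finProdFinEquiv (ℓ, ⟨i, hU.1 hd⟩))) =
            I (m ℓ) (Fin.castAdd rI ⟨i, hU.1 hd⟩)
        rw [piggybackedCode_castAdd, piggybackedCode_castAdd]
        simp only [mergeMessages, Equiv.symm_apply_apply]
      readAmount := b
      download := dl
      writeAmount := fun _ => α
      send := g
      store := fun _ => id
      store_spec := fun m e he => hg e he m }
  refine ⟨C, ⟨fun d hd d' hd' => ?_, fun d hd => ?_⟩, ?_⟩
  · simp only [C, b, hU.1 hd, hU.1 hd', if_true]
  · have hb : b d = α := if_neg fun h => hd (hU.2 h)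
    refine ⟨hb, fun s s' h => funext fun t => ?_⟩
    exact congrFun h ⟨t, t.2.trans_eq hb.symm⟩
  · have hread : C.readBandwidth = lam * (k * β + rI * α) := by
      simp only [MDSConvertibleCode.readBandwidth, C, b]
      rw [Fintype.sum_prod_type]
      simp [Fin.sum_univ_add]
    have hnew : C.newDisks = Finset.univ.map (Fin.natAddEmb (lam * k)) := by
      ext e
      rw [C.mem_newDisks]
      change e ∉ Set.range pl ↔ _
      rw [hrange]
      refine Fin.addCases (fun c => ?_) (fun j => ?_) e
      · have : ∀ a : Fin rF, lam * k + (a : ℕ) ≠ c := fun a h => by have := c.2; omega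
        simp [Fin.ext_iff, this]
      · simp
    have hwrite : C.writeBandwidth = rF * α := by
      simp [MDSConvertibleCode.writeBandwidth, hnew, C]
    rw [MDSConvertibleCode.bandwidthCost, hread, hwrite]

/-- Whenever `rF` divides `α * rI`, the lower bound on the bandwidth cost is attained by a code with
uniform download. -/
theorem exists_optimal_code {lam k rI rF α : ℕ} (hlam : 0 < lam) (hI : rI < rF)
    (hα : rF ∣ α * rI) :
    ∃ (F : Type) (_ : Field F) (_ : Finite F) (C : MDSConvertibleCode F lam k rI rF α),
      C.HasUniformDownload ∧ rF * C.bandwidthCost + lam * (k * (rI * α)) =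
        lam * (rF * ((k + rI) * α)) + rF * (rF * α) := by
  obtain ⟨p, hp, M, D, Q, hM, hQ, hMQ⟩ := exists_superregular_blocks lam k rF hlam
  -- `a = α * rI / rF` is the number of high layers.
  obtain ⟨a, ha⟩ := hα
  have hle : a ≤ α := by
    refine Nat.le_of_mul_le_mul_left (ha ▸ ?_) (show 0 < rF by omega)
    rw [mul_comm rF]
    exact Nat.mul_le_mul_left α hI.le
  obtain ⟨β, rfl⟩ := Nat.exists_eq_add_of_le' hle
  obtain ⟨C, hC, hcost⟩ := exists_piggybacked_convertible_code (k := k) (β := β) hI.le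
    (Nat.le_add_right β a) (by rw [ha]; ring) hM hQ hMQ
  refine ⟨ZMod p, inferInstance, inferInstance, C, hC, ?_⟩
  rw [hcost]
  have : lam * (k * (rI * (β + a))) = lam * (k * (rF * a)) := by rw [← ha]; ring
  rw [this]
  ring

theorem mainTheorem9 (lam k rI rF : ℕ) (hlam : 2 ≤ lam) (hI : rI < rF) (hF : rF < k) :
    (∀ (F : Type*) [Field F] [Finite F] (α : ℕ), 0 < α →
      ∀ C : MDSConvertibleCode F lam k rI rF α,
        C.IsBandwidthOptimal → C.HasUniformDownload →
          rF ∣ α * rI ∧ rF / Nat.gcd rF rI ≤ α) ∧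
    (∃ (F : Type) (_ : Field F) (_ : Finite F)
      (C : MDSConvertibleCode F lam k rI rF (rF / Nat.gcd rF rI)),
        C.IsBandwidthOptimal ∧ C.HasUniformDownload) := by
  have hrF : 0 < rF := by omega
  have hgcd : 0 < Nat.gcd rF rI := Nat.gcd_pos_of_pos_left _ hrF
  set α₀ := rF / Nat.gcd rF rI with hα₀
  have hpos : 0 < α₀ := Nat.div_pos (Nat.gcd_le_left _ hrF) hgcd
  have hdvd : rF ∣ α₀ * rI := by
    obtain ⟨c, hc⟩ := Nat.gcd_dvd_right rF rI
    refine ⟨c, ?_⟩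
    conv_lhs => rw [hc]
    rw [← mul_assoc, hα₀, Nat.div_mul_cancel (Nat.gcd_dvd_left _ _)]
  -- `C₀` is both the witness for attainment and the competitor that forces every optimal code to
  -- meet the lower bound.
  obtain ⟨F₀, _, _, C₀, hU₀, hC₀⟩ := exists_optimal_code (k := k) (by omega : 0 < lam) hI hdvd
  refine ⟨fun F _ _ α hα C hopt hU => ?_, F₀, inferInstance, inferInstance, C₀, ?_, hU₀⟩
  · have h : rF ∣ α * rI := by
      refine C.dvd_of_bandwidthCost_le hlam hI hF hα ?_ hU
      have h1 := Nat.mul_le_mul_left rF (hopt F₀ α₀ hpos C₀)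
      have h2 := congrArg (α * ·) hC₀
      refine Nat.le_of_mul_le_mul_left ?_ hpos
      nlinarith
    refine ⟨h, Nat.le_of_dvd hα ?_⟩
    exact (Nat.Coprime.dvd_of_dvd_mul_right (Nat.coprime_div_gcd_div_gcd hgcd)
      (by
        rw [← Nat.mul_div_assoc _ (Nat.gcd_dvd_right _ _)]
        exact Nat.div_dvd_div (Nat.gcd_dvd_left _ _) h))
  · intro F' _ _ α' hα' C'
    have h1 := Nat.mul_le_mul_left α₀ (C'.le_bandwidthCost hlam hI hF hα')
    have h2 := congrArg (α' * ·) hC₀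
    refine Nat.le_of_mul_le_mul_left ?_ hrF
    nlinarith
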